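/- Let $A$ be an $n\times n$ Hermitian positive semidefinite complex matrix and let $d=\operatorname{rank}(A)$. Then $A$ can be written as $A=VV^\dagger$ with $V\in\mathbb C^{n\times d}$ of full column rank. For such a $V$, let $v_i\in\mathbb C^d$ be the column vector for which $v_i^\dagger$ is the $i$th row of $V$, so that $A_{ij}=v_i^\dagger v_j$. If $A$ has no zero diagonal entry, then the maximum $$\Phi(V)=\max_{X\succ0}\Big(\sum_{i=1}^n\log(v_i^\dagger Xv_i)+\log\det X-\operatorname{tr}X+d\Big)$$ over all $d\times d$ Hermitian positive definite matrices $X$ is attained, and its value does not depend on the choice of $V$. Set $\widehat P(A)=e^{\Phi(V)}$ in this case, and $\widehat P(A)=0$ if $A$ has a zero diagonal entry. Then the permanent $\operatorname{per}(A)=\sum_{\sigma\in S_n}\prod_{i=1}^nA_{i,\sigma(i)}$ is a real number, and $$e^{-\gamma n}\,\widehat P(A)\le\operatorname{per}(A)\le\widehat P(A),$$ where $\gamma$ is the Euler–Mascheroni constant. -/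

import Mathlib

open scoped Matrix ComplexOrder

noncomputable section

namespace EntropicPermanent

/-- `V` is a full-rank Gram factor of `A`: `A = V V†` and `V` has full column rank `d`. -/
def IsGramFactor {n d : ℕ} (A : Matrix (Fin n) (Fin n) ℂ) (V : Matrix (Fin n) (Fin d) ℂ) : Prop :=
  A = V * Vᴴ ∧ V.rank = d

/-- The column vector `v_i ∈ ℂ^d` for which `v_i†` is the `i`-th row of `V`. -/
def rowVec {n d : ℕ} (V : Matrix (Fin n) (Fin d) ℂ) (i : Fin n) : Fin d → ℂ :=
  star (V i)

/-- The objective `φ_V(X) = ∑ i, log (v_i† X v_i) + log det X - tr X + d`.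
For positive definite `X` the numbers `v_i† X v_i`, `det X` and `tr X` are real. -/
def objective {n d : ℕ} (V : Matrix (Fin n) (Fin d) ℂ) (X : Matrix (Fin d) (Fin d) ℂ) : ℝ :=
  (∑ i, Real.log (star (rowVec V i) ⬝ᵥ (X *ᵥ rowVec V i)).re)
    + Real.log X.det.re - X.trace.re + d

/-- `Φ(V)`, the maximum of `φ_V` over positive definite `X`, written as a supremum.
That it is attained is part of the theorem. -/
def Phi {n d : ℕ} (V : Matrix (Fin n) (Fin d) ℂ) : ℝ :=
  sSup (objective V '' {X | X.PosDef})

/-- A full-rank Gram factor of `A`, with `d = rank A`, picked arbitrarily. That one exists, and that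
`Φ` does not depend on which is picked, is part of the theorem. -/
def gramFactor {n : ℕ} (A : Matrix (Fin n) (Fin n) ℂ) : Matrix (Fin n) (Fin A.rank) ℂ :=
  Classical.epsilon (IsGramFactor A)

open Classical in
/-- `P̂(A) = exp Φ(V)` for a full-rank Gram factor `V` of `A`, and `P̂(A) = 0` if `A` has a zero
diagonal entry. -/
def hatP {n : ℕ} (A : Matrix (Fin n) (Fin n) ℂ) : ℝ :=
  if ∃ i, A i i = 0 then 0 else Real.exp (Phi (gramFactor A))

end EntropicPermanent

end

namespace EntropicPermanent

open MeasureTheory Real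
open scoped ComplexConjugate

/-! Write `A = V Vᴴ`. Wick's formula (`ofReal_integral_prod_mulVec`) gives π^d per(A) as the
integral of ∏ |(Vz)_i|² e^{-|z|²} over ℂ^d, so the permanent is real. For X = S Sᴴ positive
definite, the substitution z ↦ Sz has Jacobian |det S|² and leads to both bounds.

Lower bound, valid for every X: apply Jensen's inequality to the exponential under the standard
Gaussian. If u ≠ 0, then log |u·z|² has mean log |u|² - γ, so each of the n factors costs e^{-γ}
(`exp_objective_le_integral`).

Upper bound, at a maximizer X: put a_i = v_i† X v_i. The first-order condition along rank-one
perturbations gives |Sz|² ≥ |z|² + ∑ |(VSz)_i|²/a_i, and the one along scalings gives tr X = n + d.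
The integrand is then bounded pointwise, using y e^{-y/a} ≤ a/e in each factor
(`integral_le_exp_objective`).

A maximizer exists because e^φ extends continuously by zero to singular matrices and decays as the
trace grows (`exists_isMax_objective`). Two full-rank factors differ by a unitary, which the
objective absorbs (`phi_eq_of_isGramFactor`). -/

/-! ### Gaussian moments and Wick's formula -/

theorem integrable_norm_pow_mul_exp (m : ℕ) :
    Integrable fun z : ℂ => ‖z‖ ^ m * rexp (-‖z‖ ^ 2) := by
  rw [integrable_fun_norm_addHaar volume (f := fun r => r ^ m * rexp (-r ^ 2))]
  have h := integrableOn_rpow_mul_exp_neg_rpow (p := 2) (s := m + 1)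
    (by linarith [Nat.cast_nonneg (α := ℝ) m]) (by norm_num)
  refine h.congr_fun (fun r hr => ?_) measurableSet_Ioi
  have hr : 0 < r := hr
  simp only [Complex.finrank_real_complex, smul_eq_mul]
  norm_cast
  ring_nf

theorem integrable_pow_mul_conj_pow_mul_exp (a b : ℕ) :
    Integrable fun z : ℂ => z ^ a * conj z ^ b * (rexp (-‖z‖ ^ 2) : ℂ) := by
  refine (integrable_norm_pow_mul_exp (a + b)).mono' ?_ ?_
  · exact (by fun_prop : Continuous _).aestronglyMeasurable
  · filter_upwards with z
    simp only [norm_mul, norm_pow, RCLike.norm_conj, Complex.norm_real, norm_eq_abs, abs_exp]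
    rw [pow_add]

theorem integral_norm_pow_mul_exp (a : ℕ) :
    ∫ z : ℂ, ‖z‖ ^ (2 * a) * rexp (-‖z‖ ^ 2) = π * a.factorial := by
  have h := Complex.integral_rpow_mul_exp_neg_rpow (p := 2) (q := 2 * a) (by norm_num)
    (by linarith [Nat.cast_nonneg (α := ℝ) a])
  have e : ((2 * a + 2) / 2 : ℝ) = a + 1 := by ring
  rw [e, Real.Gamma_nat_eq_factorial] at h
  norm_num at h
  rw [← h]
  congr 1 with z
  norm_cast

theorem integral_pow_mul_conj_pow_mul_exp (a b : ℕ) :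
    ∫ z : ℂ, z ^ a * conj z ^ b * (rexp (-‖z‖ ^ 2) : ℂ)
      = π * (if a = b then (a.factorial : ℂ) else 0) := by
  split_ifs with hab
  · subst hab
    have h := congrArg (fun x : ℝ => (x : ℂ)) (integral_norm_pow_mul_exp a)
    simp only [Complex.ofReal_mul, Complex.ofReal_natCast] at h
    rw [← h, ← integral_complex_ofReal]
    congr 1 with z
    rw [← mul_pow, Complex.mul_conj, Complex.normSq_eq_norm_sq]
    push_cast
    rw [pow_mul]
  · have hab' : (a : ℝ) - b ≠ 0 := sub_ne_zero.2 (by exact_mod_cast hab)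
    -- The angle makes c^a c̄^b = e^{iπ}, so rotating by c negates the integrand while preserving
    -- the measure.
    let c : Circle := Circle.exp (π / (a - b))
    have hc : (c : ℂ) ^ a * conj (c : ℂ) ^ b = -1 := by
      simp only [c, Circle.coe_exp, ← Complex.exp_conj, ← Complex.exp_nat_mul, ← Complex.exp_add]
      rw [← Complex.exp_pi_mul_I]
      congr 1
      have : (a : ℂ) - b ≠ 0 := by exact_mod_cast hab'
      simp only [map_mul, Complex.conj_I, Complex.conj_ofReal]
      push_cast
      field_simp
      ring
    have h := (rotation c).measurePreserving.integral_comp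
      (rotation c).toHomeomorph.measurableEmbedding
      (fun z : ℂ => z ^ a * conj z ^ b * (rexp (-‖z‖ ^ 2) : ℂ))
    have e : ∀ z : ℂ, (rotation c z) ^ a * conj (rotation c z) ^ b *
        (rexp (-‖rotation c z‖ ^ 2) : ℂ) = -(z ^ a * conj z ^ b * (rexp (-‖z‖ ^ 2) : ℂ)) := by
      intro z
      rw [LinearIsometryEquiv.norm_map, rotation_apply, map_mul, mul_pow, mul_pow]
      linear_combination (z ^ a * conj z ^ b * (rexp (-‖z‖ ^ 2) : ℂ)) * hc
    simp only [e, integral_neg] at h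
    rw [mul_zero]
    exact self_eq_neg.1 h.symm

/-- If one such σ exists, translating by it identifies the set with the stabilizer of `f`, a product
of symmetric groups of fibres. If none exists, some fibre sizes differ. The product form matches the
coordinatewise Gaussian moments. -/
theorem card_perm_comp_eq {α ι : Type*} [Fintype α] [DecidableEq α] [Fintype ι] [DecidableEq ι]
    (f g : α → ι) :
    Fintype.card {σ : Equiv.Perm α // f ∘ σ = g} =
      ∏ k, if Fintype.card {a // f a = k} = Fintype.card {a // g a = k}
        then (Fintype.card {a // f a = k}).factorial else 0 := by
  by_cases h : ∃ σ : Equiv.Perm α, f ∘ σ = g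
  · obtain ⟨τ, rfl⟩ := h
    have hk : ∀ k, Fintype.card {a // f a = k} = Fintype.card {a // (f ∘ τ) a = k} := fun k =>
      Fintype.card_congr (τ.subtypeEquiv (by simp)).symm
    simp only [hk, if_true]
    simp only [← hk]
    rw [← DomMulAct.stabilizer_card f]
    refine Fintype.card_congr ((Equiv.mulRight τ⁻¹).subtypeEquiv fun σ => ?_)
    simp only [Equiv.coe_mulRight, Equiv.Perm.coe_mul]
    constructor
    · intro hσ
      rw [← Function.comp_assoc, hσ, Function.comp_assoc, ← Equiv.Perm.coe_mul]
      simp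
    · intro hσ
      conv_rhs => rw [← hσ]
      rw [Function.comp_assoc, Function.comp_assoc, ← Equiv.Perm.coe_mul τ⁻¹ τ]
      simp
  · have hk : ∃ k, Fintype.card {a // f a = k} ≠ Fintype.card {a // g a = k} := by
      by_contra! hk
      refine h ⟨Equiv.ofFiberEquiv fun k => Fintype.equivOfCardEq (hk k).symm, ?_⟩
      ext a
      exact Equiv.ofFiberEquiv_map _ a
    obtain ⟨k, hk⟩ := hk
    rw [Finset.prod_eq_zero (Finset.mem_univ k) (if_neg hk), Fintype.card_eq_zero_iff]
    exact ⟨fun σ => h ⟨σ.1, σ.2⟩⟩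

/-- The unnormalized standard Gaussian density on `ℂ^d`. -/
noncomputable def gaussWeight {d : ℕ} (z : Fin d → ℂ) : ℝ := rexp (-∑ k, ‖z k‖ ^ 2)

theorem gaussWeight_eq_prod {d : ℕ} (z : Fin d → ℂ) :
    gaussWeight z = ∏ k, rexp (-‖z k‖ ^ 2) := by
  rw [gaussWeight, ← Finset.sum_neg_distrib, Real.exp_sum]

theorem gaussWeight_pos {d : ℕ} (z : Fin d → ℂ) : 0 < gaussWeight z := exp_pos _

theorem prod_comp_eq_prod_pow_card {α ι R : Type*} [Fintype α] [Fintype ι] [DecidableEq ι]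
    [CommMonoid R] (f : α → ι) (z : ι → R) :
    ∏ a, z (f a) = ∏ k, z k ^ Fintype.card {a // f a = k} := by
  rw [← Finset.prod_fiberwise' Finset.univ f z]
  refine Finset.prod_congr rfl fun k _ => ?_
  rw [Finset.prod_const, Fintype.card_subtype]

theorem monomial_mul_gaussWeight {n d : ℕ} (f g : Fin n → Fin d) (z : Fin d → ℂ) :
    ((∏ i, z (f i)) * ∏ i, conj (z (g i))) * (gaussWeight z : ℂ) =
      ∏ k, (z k ^ Fintype.card {a // f a = k} * conj (z k) ^ Fintype.card {a // g a = k}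
        * (rexp (-‖z k‖ ^ 2) : ℂ)) := by
  rw [prod_comp_eq_prod_pow_card f z, prod_comp_eq_prod_pow_card g (fun k => conj (z k)),
    gaussWeight_eq_prod, Complex.ofReal_prod, ← Finset.prod_mul_distrib, ← Finset.prod_mul_distrib]

theorem integrable_monomial {n d : ℕ} (f g : Fin n → Fin d) :
    Integrable fun z : Fin d → ℂ =>
      ((∏ i, z (f i)) * ∏ i, conj (z (g i))) * (gaussWeight z : ℂ) := by
  simp only [monomial_mul_gaussWeight]
  exact Integrable.fintype_prod_dep fun k => integrable_pow_mul_conj_pow_mul_exp _ _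

theorem integral_monomial {n d : ℕ} (f g : Fin n → Fin d) :
    ∫ z : Fin d → ℂ, ((∏ i, z (f i)) * ∏ i, conj (z (g i))) * (gaussWeight z : ℂ) =
      π ^ d * ∑ σ : Equiv.Perm (Fin n), if f ∘ σ = g then 1 else 0 := by
  simp only [monomial_mul_gaussWeight]
  rw [volume_pi, integral_fintype_prod_eq_prod (𝕜 := ℂ) (fun k (x : ℂ) =>
    x ^ Fintype.card {a // f a = k} * conj x ^ Fintype.card {a // g a = k}
        * (rexp (-‖x‖ ^ 2) : ℂ))]
  simp only [integral_pow_mul_conj_pow_mul_exp]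
  rw [Finset.prod_mul_distrib, Finset.prod_const, Finset.card_univ, Fintype.card_fin]
  congr 1
  have h := card_perm_comp_eq f g
  rw [Finset.sum_boole, ← Fintype.card_subtype, h]
  push_cast
  rfl

theorem prod_mulVec_mul_conj {n d : ℕ} (V : Matrix (Fin n) (Fin d) ℂ) (z : Fin d → ℂ) :
    (∏ i, ((V *ᵥ z) i * conj ((V *ᵥ z) i))) * (gaussWeight z : ℂ) =
      ∑ f : Fin n → Fin d, ∑ g : Fin n → Fin d, ((∏ i, V i (f i)) * ∏ i, conj (V i (g i))) *
        (((∏ i, z (f i)) * ∏ i, conj (z (g i))) * (gaussWeight z : ℂ)) := by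
  rw [Finset.prod_mul_distrib]
  simp only [Matrix.mulVec, dotProduct, map_sum, map_mul]
  rw [Finset.prod_univ_sum, Finset.prod_univ_sum, Finset.sum_mul_sum, Finset.sum_mul]
  simp only [Fintype.piFinset_univ, Finset.sum_mul, Finset.prod_mul_distrib]
  refine Finset.sum_congr rfl fun f _ => Finset.sum_congr rfl fun g _ => ?_
  ring

/-- The right side is the shape taken by the Gaussian integral after expanding both products and
integrating each monomial. -/
theorem permanent_self_mul_conjTranspose {n d : ℕ} (V : Matrix (Fin n) (Fin d) ℂ) :
    (V * Vᴴ).permanent =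
      ∑ f : Fin n → Fin d, ∑ g : Fin n → Fin d, ((∏ i, V i (f i)) * ∏ i, conj (V i (g i))) *
        ∑ σ : Equiv.Perm (Fin n), if f ∘ σ = g then 1 else 0 := by
  have h : ∀ f : Fin n → Fin d,
      ∑ g : Fin n → Fin d, ((∏ i, V i (f i)) * ∏ i, conj (V i (g i))) *
        ∑ σ : Equiv.Perm (Fin n), (if f ∘ σ = g then (1 : ℂ) else 0) =
      ∑ σ : Equiv.Perm (Fin n), ∏ i, (V (σ i) (f (σ i)) * conj (V i (f (σ i)))) := by
    intro f
    simp only [Finset.mul_sum]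
    rw [Finset.sum_comm]
    refine Finset.sum_congr rfl fun σ _ => ?_
    simp only [mul_ite, mul_one, mul_zero, Finset.sum_ite_eq, Finset.mem_univ, if_true]
    rw [Finset.prod_mul_distrib, Equiv.prod_comp σ (fun i => V i (f i))]
    rfl
  simp only [h]
  rw [Finset.sum_comm, Matrix.permanent]
  refine Finset.sum_congr rfl fun σ _ => ?_
  simp only [Matrix.mul_apply, Matrix.conjTranspose_apply]
  rw [Finset.prod_univ_sum, Fintype.piFinset_univ]
  -- Reindexing by f ↦ f ∘ σ.
  exact (Fintype.sum_equiv (Equiv.arrowCongr σ.symm (Equiv.refl _)) _ _ fun f => rfl).symm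

theorem integrable_prod_mulVec_complex {n d : ℕ} (V : Matrix (Fin n) (Fin d) ℂ) :
    Integrable fun z : Fin d → ℂ =>
      (∏ i, ((V *ᵥ z) i * conj ((V *ᵥ z) i))) * (gaussWeight z : ℂ) := by
  simp only [prod_mulVec_mul_conj]
  exact integrable_finsetSum _ fun f _ => integrable_finsetSum _ fun g _ =>
    (integrable_monomial f g).const_mul _

theorem integral_prod_mulVec_complex {n d : ℕ} (V : Matrix (Fin n) (Fin d) ℂ) :
    ∫ z : Fin d → ℂ, (∏ i, ((V *ᵥ z) i * conj ((V *ᵥ z) i))) * (gaussWeight z : ℂ) =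
      π ^ d * (V * Vᴴ).permanent := by
  simp only [prod_mulVec_mul_conj]
  rw [integral_finsetSum _ fun f _ => integrable_finsetSum _ fun g _ =>
    (integrable_monomial f g).const_mul _, permanent_self_mul_conjTranspose, Finset.mul_sum]
  refine Finset.sum_congr rfl fun f _ => ?_
  rw [integral_finsetSum _ fun g _ => (integrable_monomial f g).const_mul _, Finset.mul_sum]
  refine Finset.sum_congr rfl fun g _ => ?_
  rw [integral_const_mul, integral_monomial]
  ring

theorem ofReal_prod_norm_sq_mul {n d : ℕ} (V : Matrix (Fin n) (Fin d) ℂ) (z : Fin d → ℂ) :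
    (((∏ i, ‖(V *ᵥ z) i‖ ^ 2) * gaussWeight z : ℝ) : ℂ) =
      (∏ i, ((V *ᵥ z) i * conj ((V *ᵥ z) i))) * (gaussWeight z : ℂ) := by
  simp only [Complex.mul_conj, Complex.normSq_eq_norm_sq]
  push_cast
  rfl

theorem integrable_prod_mulVec {n d : ℕ} (V : Matrix (Fin n) (Fin d) ℂ) :
    Integrable fun z : Fin d → ℂ => (∏ i, ‖(V *ᵥ z) i‖ ^ 2) * gaussWeight z := by
  have h := integrable_prod_mulVec_complex V
  simp only [← ofReal_prod_norm_sq_mul] at h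
  exact_mod_cast h.re

/-- Wick's formula: permanents of Gram matrices are Gaussian moments. -/
theorem ofReal_integral_prod_mulVec {n d : ℕ} (V : Matrix (Fin n) (Fin d) ℂ) :
    ((∫ z : Fin d → ℂ, (∏ i, ‖(V *ᵥ z) i‖ ^ 2) * gaussWeight z : ℝ) : ℂ) =
      π ^ d * (V * Vᴴ).permanent := by
  rw [← integral_prod_mulVec_complex, ← integral_complex_ofReal]
  simp only [ofReal_prod_norm_sq_mul]

/-! ### Complex linear substitutions and null hyperplanes -/

theorem det_restrictScalars_toLin' {d : ℕ} (S : Matrix (Fin d) (Fin d) ℂ) :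
    LinearMap.det ((Matrix.toLin' S).restrictScalars ℝ) = ‖S.det‖ ^ 2 := by
  rw [LinearMap.det_restrictScalars, LinearMap.det_toLin', Algebra.norm_complex_apply,
    Complex.normSq_eq_norm_sq]

/-- The real Jacobian of a complex linear map is the squared modulus of its determinant. The map is
a measurable embedding, so `F` may be arbitrary. -/
theorem integral_comp_mulVec {d : ℕ} (S : Matrix (Fin d) (Fin d) ℂ) (hS : S.det ≠ 0)
    (F : (Fin d → ℂ) → ℝ) : ∫ z, F z = ‖S.det‖ ^ 2 * ∫ z, F (S *ᵥ z) := by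
  let f : (Fin d → ℂ) →ₗ[ℝ] (Fin d → ℂ) := (Matrix.toLin' S).restrictScalars ℝ
  have hdet : LinearMap.det f = ‖S.det‖ ^ 2 := det_restrictScalars_toLin' S
  have hne : LinearMap.det f ≠ 0 := by rw [hdet]; positivity
  have hmap := Measure.map_linearMap_addHaar_eq_smul_addHaar volume hne
  let e := LinearEquiv.ofIsUnitDet (f := f) (v := Module.finBasis ℝ _) (v' := Module.finBasis ℝ _)
    (by rw [LinearMap.det_toMatrix]; exact hne.isUnit)
  have hemb : MeasurableEmbedding f :=
    e.toContinuousLinearEquiv.toHomeomorph.measurableEmbedding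
  have h := hemb.integral_map (μ := volume) F
  rw [hmap, integral_smul_measure, hdet, ENNReal.toReal_ofReal (abs_nonneg _),
    abs_of_nonneg (by positivity)] at h
  change _ = ∫ z, F (S *ᵥ z) at h
  rw [← h, smul_eq_mul]
  field_simp

theorem integrable_comp_mulVec {d : ℕ} (S : Matrix (Fin d) (Fin d) ℂ) (hS : S.det ≠ 0)
    {F : (Fin d → ℂ) → ℝ} (hF : Integrable F) : Integrable fun z => F (S *ᵥ z) := by
  let f : (Fin d → ℂ) →ₗ[ℝ] (Fin d → ℂ) := (Matrix.toLin' S).restrictScalars ℝ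
  have hdet : LinearMap.det f = ‖S.det‖ ^ 2 := det_restrictScalars_toLin' S
  have hne : LinearMap.det f ≠ 0 := by rw [hdet]; positivity
  have hmap := Measure.map_linearMap_addHaar_eq_smul_addHaar volume hne
  have hF' : Integrable F (Measure.map f volume) := by
    rw [hmap]; exact hF.smul_measure ENNReal.ofReal_ne_top
  exact hF'.comp_measurable (LinearMap.continuous_of_finiteDimensional f).measurable

theorem ae_dotProduct_ne_zero {d : ℕ} (u : Fin d → ℂ) (hu : u ≠ 0) :
    ∀ᵐ z : Fin d → ℂ, u ⬝ᵥ z ≠ 0 := by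
  let f : (Fin d → ℂ) →ₗ[ℂ] ℂ :=
    { toFun := fun z => u ⬝ᵥ z
      map_add' := fun x y => dotProduct_add u x y
      map_smul' := fun c x => by simp }
  have h := Measure.addHaar_submodule volume (LinearMap.ker f |>.restrictScalars ℝ) (by
    intro h
    apply hu
    have : star u ∈ (LinearMap.ker f).restrictScalars ℝ := h ▸ Submodule.mem_top
    have h2 : u ⬝ᵥ star u = 0 := this
    exact dotProduct_self_star_eq_zero.1 h2)
  rw [ae_iff]
  convert h using 2
  ext z
  simp [f]

/-! ### Logarithmic moments of Gaussians -/

/-- This is Γ'(1) = -γ, with Euler's integral differentiated under the integral sign. -/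
theorem integral_log_mul_exp_neg :
    ∫ t in Set.Ioi (0 : ℝ), log t * rexp (-t) = -eulerMascheroniConstant := by
  have h := Complex.hasDerivAt_GammaIntegral (s := 1) (by simp)
  have h2 : HasDerivAt Complex.GammaIntegral (-eulerMascheroniConstant : ℂ) 1 := by
    refine Complex.hasDerivAt_Gamma_one.congr_of_eventuallyEq ?_
    filter_upwards [Complex.continuous_re.continuousAt.eventually (lt_mem_nhds
      (show (0 : ℝ) < (1 : ℂ).re by simp))] with s hs
    exact (Complex.Gamma_eq_integral hs).symm
  have h3 := h.unique h2
  simp only [sub_self, Complex.cpow_zero, one_mul] at h3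
  rw [← Complex.ofReal_inj, Complex.ofReal_neg, ← h3, ← integral_complex_ofReal]
  simp

theorem integrableOn_log_mul_exp_neg :
    IntegrableOn (fun t : ℝ => log t * rexp (-t)) (Set.Ioi 0) := by
  -- The integral of a non-integrable function is 0 by convention, whereas here it is -γ ≠ 0.
  refine Integrable.of_integral_ne_zero ?_
  rw [integral_log_mul_exp_neg]
  linarith [one_half_lt_eulerMascheroniConstant]

theorem integrable_log_norm_sq_mul_exp :
    Integrable fun z : ℂ => log (‖z‖ ^ 2) * rexp (-‖z‖ ^ 2) := by
  rw [integrable_fun_norm_addHaar volume (f := fun r => log (r ^ 2) * rexp (-r ^ 2))]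
  have h := ((integrableOn_Ioi_comp_rpow_iff _ two_ne_zero).2
    integrableOn_log_mul_exp_neg).const_mul (1 / 2)
  refine IntegrableOn.congr_fun h (fun r hr => ?_) measurableSet_Ioi
  simp only [Complex.finrank_real_complex, smul_eq_mul]
  norm_num
  ring

/-- Polar coordinates followed by t = r² reduce this to the integral for Γ'(1). -/
theorem integral_log_norm_sq_mul_exp :
    ∫ z : ℂ, log (‖z‖ ^ 2) * rexp (-‖z‖ ^ 2) = π * -eulerMascheroniConstant := by
  rw [integral_fun_norm_addHaar volume (f := fun r => log (r ^ 2) * rexp (-r ^ 2)),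
    ← integral_log_mul_exp_neg, ← integral_comp_rpow_Ioi (fun t => log t * rexp (-t)) two_ne_zero]
  simp only [Complex.finrank_real_complex, smul_eq_mul, Measure.real, Complex.volume_ball]
  rw [← integral_const_mul, nsmul_eq_mul, ← integral_const_mul, ← integral_const_mul]
  refine setIntegral_congr_fun measurableSet_Ioi fun r hr => ?_
  norm_num
  ring

theorem integrable_exp_neg_norm_sq : Integrable fun z : ℂ => rexp (-‖z‖ ^ 2) := by
  simpa using integrable_norm_pow_mul_exp 0

theorem integral_exp_neg_norm_sq : ∫ z : ℂ, rexp (-‖z‖ ^ 2) = π := by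
  simpa using integral_norm_pow_mul_exp 0

theorem integrable_gaussWeight (d : ℕ) : Integrable (gaussWeight (d := d)) := by
  have : gaussWeight (d := d) = fun z => ∏ k, rexp (-‖z k‖ ^ 2) := funext gaussWeight_eq_prod
  rw [this]
  exact Integrable.fintype_prod fun _ => integrable_exp_neg_norm_sq

theorem integral_gaussWeight (d : ℕ) : ∫ z : Fin d → ℂ, gaussWeight z = π ^ d := by
  simp only [gaussWeight_eq_prod]
  rw [volume_pi, integral_fintype_prod_eq_prod (𝕜 := ℝ) (fun _ (x : ℂ) => rexp (-‖x‖ ^ 2))]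
  simp [integral_exp_neg_norm_sq]

/-- Puts a function of one coordinate in product form, so that Fubini applies. -/
theorem apply_mul_gaussWeight {d : ℕ} (k : Fin d) (F : ℂ → ℝ) (z : Fin d → ℂ) :
    F (z k) * gaussWeight z =
      ∏ j, ((if j = k then F (z j) else 1) * rexp (-‖z j‖ ^ 2)) := by
  rw [Finset.prod_mul_distrib, ← gaussWeight_eq_prod]
  simp

theorem integrable_log_coord {d : ℕ} (k : Fin d) :
    Integrable fun z : Fin d → ℂ => log (‖z k‖ ^ 2) * gaussWeight z := by
  simp only [apply_mul_gaussWeight k fun x => log (‖x‖ ^ 2)]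
  refine Integrable.fintype_prod_dep
    (f := fun j (x : ℂ) => (if j = k then log (‖x‖ ^ 2) else 1) * rexp (-‖x‖ ^ 2)) fun j => ?_
  by_cases h : j = k
  · simpa [h] using integrable_log_norm_sq_mul_exp
  · simpa [h] using integrable_exp_neg_norm_sq

theorem integral_log_coord {d : ℕ} (k : Fin d) :
    ∫ z : Fin d → ℂ, log (‖z k‖ ^ 2) * gaussWeight z = π ^ d * -eulerMascheroniConstant := by
  simp only [apply_mul_gaussWeight k fun x => log (‖x‖ ^ 2)]
  rw [volume_pi, integral_fintype_prod_eq_prod (𝕜 := ℝ)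
    (fun j (x : ℂ) => (if j = k then log (‖x‖ ^ 2) else 1) * rexp (-‖x‖ ^ 2))]
  have h : ∀ j, ∫ x : ℂ, (if j = k then log (‖x‖ ^ 2) else 1) * rexp (-‖x‖ ^ 2) =
      π * if j = k then -eulerMascheroniConstant else 1 := by
    intro j
    by_cases h : j = k
    · simp only [h, if_true, integral_log_norm_sq_mul_exp]
    · simp only [h, if_false, one_mul, integral_exp_neg_norm_sq, mul_one]
  simp only [h, Finset.prod_mul_distrib]
  simp

theorem sum_norm_sq_mulVec_of_unitary {d : ℕ} (U : Matrix (Fin d) (Fin d) ℂ) (hU : Uᴴ * U = 1)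
    (z : Fin d → ℂ) : ∑ k, ‖(U *ᵥ z) k‖ ^ 2 = ∑ k, ‖z k‖ ^ 2 := by
  have e : ∀ x : Fin d → ℂ, ((∑ k, ‖x k‖ ^ 2 : ℝ) : ℂ) = star x ⬝ᵥ x := by
    intro x
    simp only [dotProduct, Pi.star_apply, RCLike.star_def, Complex.conj_mul']
    push_cast
    rfl
  rw [← Complex.ofReal_inj, e, e, Matrix.star_mulVec, Matrix.dotProduct_mulVec,
    Matrix.vecMul_vecMul, hU, Matrix.vecMul_one]

/-- The columns of `U` are an orthonormal basis whose `k`-th member is the normalized conjugate of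
`u`. -/
theorem exists_unitary_vecMul_eq_single {d : ℕ} (u : Fin d → ℂ) (hu : u ≠ 0) :
    ∃ (U : Matrix (Fin d) (Fin d) ℂ) (k : Fin d), Uᴴ * U = 1 ∧
      ∃ c : ℂ, ‖c‖ ^ 2 = ∑ j, ‖u j‖ ^ 2 ∧ u ᵥ* U = Pi.single k c := by
  obtain ⟨k, -⟩ := Function.ne_iff.1 hu
  let v : EuclideanSpace ℂ (Fin d) := WithLp.toLp 2 (star u)
  have hv : v ≠ 0 := by
    intro h
    apply hu
    ext j
    have := congrArg (fun w : EuclideanSpace ℂ (Fin d) => w j) h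
    simpa [v] using this
  have hvn : (‖v‖ : ℂ) ≠ 0 := by simpa using hv
  have ho : Orthonormal ℂ (({k} : Set (Fin d)).domRestrict
      fun _ => ((‖v‖ : ℂ)⁻¹ • v : EuclideanSpace ℂ (Fin d))) := by
    constructor
    · intro i
      simp only [Set.domRestrict_apply]
      rw [norm_smul, norm_inv, Complex.norm_real, norm_norm, inv_mul_cancel₀]
      simpa using hv
    · intro i j hij
      exact absurd (Subsingleton.elim i j) hij
  obtain ⟨b, hb⟩ := ho.exists_orthonormalBasis_extension_of_card_eq (by simp)
  have hbk := hb k rfl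
  have hin := fun i j => orthonormal_iff_ite.1 b.orthonormal i j
  have hvk : v = (‖v‖ : ℂ) • b k := by rw [hbk, smul_inv_smul₀ hvn]
  refine ⟨Matrix.of fun j l => b l j, k, ?_, ‖v‖, ?_, ?_⟩
  · ext i j
    rw [Matrix.one_apply, ← hin i j, Matrix.mul_apply, PiLp.inner_apply]
    simp [mul_comm]
  · rw [Complex.norm_real, norm_norm, EuclideanSpace.norm_sq_eq]
    simp [v]
  · ext l
    have h : (u ᵥ* Matrix.of fun j l => b l j) l = inner ℂ v (b l) := by
      rw [PiLp.inner_apply]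
      simp [v, Matrix.vecMul, dotProduct, mul_comm]
    rw [h, hvk, inner_smul_left, hin, Pi.single_apply]
    simp [eq_comm, hvk.symm]

/-- By unitary invariance u·z may be replaced by c z_k with |c| = |u|, leaving a one-variable
integral. -/
theorem log_dotProduct_gaussian {d : ℕ} (u : Fin d → ℂ) (hu : u ≠ 0) :
    (Integrable fun z : Fin d → ℂ => log (‖u ⬝ᵥ z‖ ^ 2) * gaussWeight z) ∧
    ∫ z : Fin d → ℂ, log (‖u ⬝ᵥ z‖ ^ 2) * gaussWeight z =
      π ^ d * (log (∑ j, ‖u j‖ ^ 2) - eulerMascheroniConstant) := by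
  obtain ⟨U, k, hU, c, hc, huU⟩ := exists_unitary_vecMul_eq_single u hu
  have hU' : U * Uᴴ = 1 := mul_eq_one_comm.1 hU
  have hdet : ‖U.det‖ ^ 2 = 1 := by
    have := congrArg Matrix.det hU'
    rw [Matrix.det_mul, Matrix.det_conjTranspose, Matrix.det_one, RCLike.star_def,
      Complex.mul_conj'] at this
    exact_mod_cast this
  have hdet0 : U.det ≠ 0 := by intro h; simp [h] at hdet
  have hdet1 : Uᴴ.det ≠ 0 := by rw [Matrix.det_conjTranspose]; simpa using hdet0
  have hc0 : ‖c‖ ^ 2 ≠ 0 := by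
    intro h
    have : c = 0 := by simpa using h
    rw [this, Pi.single_zero] at huU
    apply hu
    rw [← Matrix.vecMul_one u, ← hU', ← Matrix.vecMul_vecMul, huU, Matrix.zero_vecMul]
  have hw : ∀ z, gaussWeight (U *ᵥ z) = gaussWeight z := fun z => by
    rw [gaussWeight, sum_norm_sq_mulVec_of_unitary U hU, gaussWeight]
  have hdot : ∀ z, u ⬝ᵥ (U *ᵥ z) = c * z k := fun z => by
    rw [Matrix.dotProduct_mulVec, huU, single_dotProduct]
  have hae : ∀ᵐ z : Fin d → ℂ, log (‖c * z k‖ ^ 2) * gaussWeight z =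
      log (‖c‖ ^ 2) * gaussWeight z + log (‖z k‖ ^ 2) * gaussWeight z := by
    filter_upwards [ae_dotProduct_ne_zero (Pi.single k 1) (by simp)] with z hz
    have hz : z k ≠ 0 := by simpa using hz
    rw [norm_mul, mul_pow, log_mul hc0 (by simpa using hz)]
    ring
  have hi : Integrable fun z : Fin d → ℂ => log (‖c * z k‖ ^ 2) * gaussWeight z :=
    (((integrable_gaussWeight d).const_mul _).add (integrable_log_coord k)).congr
      (hae.mono fun z hz => hz.symm)
  constructor
  · have h := integrable_comp_mulVec Uᴴ hdet1 hi
    refine h.congr (Filter.Eventually.of_forall fun z => ?_)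
    simp only
    rw [← hdot, ← hw, Matrix.mulVec_mulVec, hU', Matrix.one_mulVec]
  · rw [integral_comp_mulVec U hdet0, hdet, one_mul]
    simp only [hw, hdot]
    rw [integral_congr_ae hae, integral_add ((integrable_gaussWeight d).const_mul _)
      (integrable_log_coord k), integral_const_mul, integral_gaussWeight, integral_log_coord, hc]
    ring

/-! ### The objective in terms of a factor S with X = S Sᴴ -/

theorem objective_eq {n d : ℕ} (V : Matrix (Fin n) (Fin d) ℂ) (X : Matrix (Fin d) (Fin d) ℂ) :
    objective V X = (∑ i, log ((V * X * Vᴴ) i i).re) + log X.det.re - X.trace.re + d := by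
  have h : ∀ i, star (rowVec V i) ⬝ᵥ (X *ᵥ rowVec V i) = (V * X * Vᴴ) i i := by
    intro i
    rw [rowVec, star_star, Matrix.dotProduct_mulVec, Matrix.mul_apply]
    rfl
  simp only [objective, h]

theorem self_mul_conjTranspose_apply_self {m d : Type*} [Fintype d]
    (M : Matrix m d ℂ) (i : m) : (M * Mᴴ) i i = ((∑ j, ‖M i j‖ ^ 2 : ℝ) : ℂ) := by
  rw [Matrix.mul_apply]
  push_cast
  refine Finset.sum_congr rfl fun j _ => ?_
  rw [Matrix.conjTranspose_apply, RCLike.star_def, Complex.mul_conj']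

theorem posDef_self_mul_conjTranspose {d : ℕ} {S : Matrix (Fin d) (Fin d) ℂ} (hS : S.det ≠ 0) :
    (S * Sᴴ).PosDef :=
  Matrix.PosDef.mul_conjTranspose_self S
    (Matrix.vecMul_injective_of_isUnit ((Matrix.isUnit_iff_isUnit_det S).2 hS.isUnit))

open scoped MatrixOrder in
theorem exists_eq_self_mul_conjTranspose {d : ℕ} {X : Matrix (Fin d) (Fin d) ℂ} (hX : X.PosDef) :
    ∃ S : Matrix (Fin d) (Fin d) ℂ, S.det ≠ 0 ∧ X = S * Sᴴ := by
  obtain ⟨B, hB⟩ := CStarAlgebra.nonneg_iff_eq_star_mul_self.1 hX.posSemidef.nonneg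
  have hB' : X = Bᴴ * Bᴴᴴ := by rw [Matrix.conjTranspose_conjTranspose]; exact hB
  refine ⟨Bᴴ, fun h => ?_, hB'⟩
  have := hX.det_pos.ne'
  rw [hB', Matrix.det_mul, h, zero_mul] at this
  exact this rfl

theorem det_self_mul_conjTranspose_re {d : ℕ} (S : Matrix (Fin d) (Fin d) ℂ) :
    (S * Sᴴ).det.re = ‖S.det‖ ^ 2 := by
  rw [Matrix.det_mul, Matrix.det_conjTranspose, RCLike.star_def, Complex.mul_conj']
  norm_cast

theorem trace_self_mul_conjTranspose_re {d : ℕ} (S : Matrix (Fin d) (Fin d) ℂ) :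
    (S * Sᴴ).trace.re = ∑ k, ∑ j, ‖S k j‖ ^ 2 := by
  simp only [Matrix.trace, Matrix.diag_apply, self_mul_conjTranspose_apply_self, Complex.re_sum,
    Complex.ofReal_re]

theorem mul_self_mul_conjTranspose_apply_self {n d : ℕ} (V : Matrix (Fin n) (Fin d) ℂ)
    (S : Matrix (Fin d) (Fin d) ℂ) (i : Fin n) :
    (V * (S * Sᴴ) * Vᴴ) i i = ((∑ j, ‖(V * S) i j‖ ^ 2 : ℝ) : ℂ) := by
  rw [← self_mul_conjTranspose_apply_self, Matrix.conjTranspose_mul]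
  simp only [Matrix.mul_assoc]

theorem objective_self_mul_conjTranspose {n d : ℕ} (V : Matrix (Fin n) (Fin d) ℂ)
    (S : Matrix (Fin d) (Fin d) ℂ) :
    objective V (S * Sᴴ) = (∑ i, log (∑ j, ‖(V * S) i j‖ ^ 2)) + log (‖S.det‖ ^ 2)
      - (∑ k, ∑ j, ‖S k j‖ ^ 2) + d := by
  simp only [objective_eq, det_self_mul_conjTranspose_re, trace_self_mul_conjTranspose_re,
    mul_self_mul_conjTranspose_apply_self, Complex.ofReal_re]

theorem mul_row_ne_zero {n d : ℕ} {V : Matrix (Fin n) (Fin d) ℂ} {S : Matrix (Fin d) (Fin d) ℂ}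
    (hS : S.det ≠ 0) {i : Fin n} (hV : V i ≠ 0) : (V * S) i ≠ 0 := by
  intro h
  apply hV
  have h2 : V i ᵥ* S = 0 := h
  exact Matrix.eq_zero_of_vecMul_eq_zero hS h2

theorem sum_norm_sq_pos {d : ℕ} {u : Fin d → ℂ} (hu : u ≠ 0) : 0 < ∑ j, ‖u j‖ ^ 2 := by
  obtain ⟨j, hj⟩ := Function.ne_iff.1 hu
  exact Finset.sum_pos' (fun _ _ => by positivity)
    ⟨j, Finset.mem_univ _, by have : u j ≠ 0 := hj; positivity⟩

/-! ### Lower bound by Jensen's inequality -/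

theorem norm_sq_gaussian {d : ℕ} (u : Fin d → ℂ) :
    (Integrable fun z : Fin d → ℂ => ‖u ⬝ᵥ z‖ ^ 2 * gaussWeight z) ∧
    ∫ z : Fin d → ℂ, ‖u ⬝ᵥ z‖ ^ 2 * gaussWeight z = π ^ d * ∑ j, ‖u j‖ ^ 2 := by
  -- Wick's formula for a matrix with the single row `u`.
  have h1 := integrable_prod_mulVec (Matrix.of fun _ : Fin 1 => u)
  have h2 := ofReal_integral_prod_mulVec (Matrix.of fun _ : Fin 1 => u)
  rw [Matrix.permanent_unique, self_mul_conjTranspose_apply_self] at h2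
  simp only [Finset.univ_unique, Finset.prod_singleton] at h1 h2
  exact ⟨h1, by exact_mod_cast h2⟩

theorem sum_norm_sq_gaussian {d : ℕ} (S : Matrix (Fin d) (Fin d) ℂ) :
    (Integrable fun z : Fin d → ℂ => (∑ k, ‖(S *ᵥ z) k‖ ^ 2) * gaussWeight z) ∧
    ∫ z : Fin d → ℂ, (∑ k, ‖(S *ᵥ z) k‖ ^ 2) * gaussWeight z =
      π ^ d * ∑ k, ∑ j, ‖S k j‖ ^ 2 := by
  simp only [Finset.sum_mul, Finset.mul_sum]
  refine ⟨integrable_finsetSum _ fun k _ => (norm_sq_gaussian (S k)).1, ?_⟩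
  have hi : ∀ k ∈ Finset.univ, Integrable fun z : Fin d → ℂ => ‖(S *ᵥ z) k‖ ^ 2 * gaussWeight z :=
    fun k _ => (norm_sq_gaussian (S k)).1
  rw [integral_finsetSum _ hi]
  refine Finset.sum_congr rfl fun k _ => ?_
  rw [← Finset.mul_sum]
  exact (norm_sq_gaussian (S k)).2

/-- Jensen's inequality for the Gaussian with covariance `S Sᴴ`. -/
theorem exp_objective_le_integral {n d : ℕ} (V : Matrix (Fin n) (Fin d) ℂ) (hV : ∀ i, V i ≠ 0)
    (S : Matrix (Fin d) (Fin d) ℂ) (hS : S.det ≠ 0) :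
    π ^ d * rexp (objective V (S * Sᴴ) - eulerMascheroniConstant * n) ≤
      ∫ z : Fin d → ℂ, (∏ i, ‖(V *ᵥ z) i‖ ^ 2) * gaussWeight z := by
  have hM : ∀ i, (V * S) i ≠ 0 := fun i => mul_row_ne_zero hS (hV i)
  rw [integral_comp_mulVec S hS]
  have hint := integrable_comp_mulVec S hS (integrable_prod_mulVec V)
  -- `c` is the mean of the exponent `g` below under the normalized Gaussian.
  set c : ℝ := (∑ i, (log (∑ j, ‖(V * S) i j‖ ^ 2) - eulerMascheroniConstant))
    - (∑ k, ∑ j, ‖S k j‖ ^ 2) + d with hc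
  have hobj : objective V (S * Sᴴ) - eulerMascheroniConstant * n = c + log (‖S.det‖ ^ 2) := by
    rw [objective_self_mul_conjTranspose, hc, Finset.sum_sub_distrib]
    simp
    ring
  -- The substituted integrand is e^g times `gaussWeight z`. The last sum is |z|², written with the
  -- identity matrix so that `sum_norm_sq_gaussian` applies to it.
  let g : (Fin d → ℂ) → ℝ := fun z => (∑ i, log (‖((V * S) *ᵥ z) i‖ ^ 2))
    - (∑ k, ‖(S *ᵥ z) k‖ ^ 2) + ∑ k, ‖((1 : Matrix (Fin d) (Fin d) ℂ) *ᵥ z) k‖ ^ 2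
  have h1 := fun i => log_dotProduct_gaussian ((V * S) i) (hM i)
  have h2 := sum_norm_sq_gaussian S
  have h3 := sum_norm_sq_gaussian (1 : Matrix (Fin d) (Fin d) ℂ)
  have hgw : (fun z => g z * gaussWeight z) = fun z =>
      (∑ i, log (‖((V * S) *ᵥ z) i‖ ^ 2) * gaussWeight z)
      - (∑ k, ‖(S *ᵥ z) k‖ ^ 2) * gaussWeight z
      + (∑ k, ‖((1 : Matrix (Fin d) (Fin d) ℂ) *ᵥ z) k‖ ^ 2) * gaussWeight z := by
    ext z
    simp only [g, ← Finset.sum_mul]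
    ring
  have hs : Integrable fun z => ∑ i, log (‖((V * S) *ᵥ z) i‖ ^ 2) * gaussWeight z :=
    integrable_finsetSum _ fun i _ => (h1 i).1
  have hs2 : Integrable fun z => (∑ i, log (‖((V * S) *ᵥ z) i‖ ^ 2) * gaussWeight z)
      - (∑ k, ‖(S *ᵥ z) k‖ ^ 2) * gaussWeight z := hs.sub h2.1
  have hs1 : ∀ i ∈ Finset.univ, Integrable fun z => log (‖((V * S) *ᵥ z) i‖ ^ 2) * gaussWeight z :=
    fun i _ => (h1 i).1
  have hgi : Integrable fun z => g z * gaussWeight z := by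
    rw [hgw]
    exact hs2.add h3.1
  have hone : ∑ k : Fin d, ∑ j, ‖(1 : Matrix (Fin d) (Fin d) ℂ) k j‖ ^ 2 = d := by
    simp [Matrix.one_apply, apply_ite]
  have hgint : ∫ z, g z * gaussWeight z = π ^ d * c := by
    rw [hgw, integral_add hs2 h3.1, integral_sub hs h2.1, h2.2, h3.2, hone,
      integral_finsetSum _ hs1, hc]
    have : ∀ i, ∫ z, log (‖((V * S) *ᵥ z) i‖ ^ 2) * gaussWeight z = _ := fun i => (h1 i).2
    simp only [this]
    rw [← Finset.mul_sum]
    ring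
  -- Jensen through the tangent line e^g ≥ e^c (1 + g - c); the left side integrates to π^d e^c.
  -- Null hyperplanes are discarded so that each logarithm can be exponentiated back.
  have hae : ∀ᵐ z : Fin d → ℂ, rexp c * ((1 - c) * gaussWeight z + g z * gaussWeight z) ≤
      (∏ i, ‖(V *ᵥ (S *ᵥ z)) i‖ ^ 2) * gaussWeight (S *ᵥ z) := by
    have := ae_all_iff.2 fun i => ae_dotProduct_ne_zero _ (hM i)
    filter_upwards [this] with z hz
    have hz' : ∀ i, 0 < ‖((V * S) *ᵥ z) i‖ ^ 2 := fun i => by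
      have : ((V * S) *ᵥ z) i ≠ 0 := hz i
      positivity
    have hval : (∏ i, ‖(V *ᵥ (S *ᵥ z)) i‖ ^ 2) * gaussWeight (S *ᵥ z) =
        rexp (g z) * gaussWeight z := by
      simp only [g, Matrix.mulVec_mulVec, gaussWeight, Matrix.one_mulVec]
      rw [← Real.exp_add, add_assoc, add_neg_cancel, add_zero, sub_eq_add_neg, Real.exp_add,
        Real.exp_sum]
      simp only [exp_log (hz' _)]
    rw [hval]
    have he : rexp (g z) = rexp c * rexp (g z - c) := by rw [← Real.exp_add]; ring_nf
    have := add_one_le_exp (g z - c)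
    rw [he, ← add_mul, mul_assoc]
    have hw := (gaussWeight_pos z).le
    gcongr
    linarith
  have hle := integral_mono_ae
    ((((integrable_gaussWeight d).const_mul (1 - c)).add hgi).const_mul (rexp c)) hint hae
  have hlhs : ∫ z : Fin d → ℂ, rexp c * ((1 - c) * gaussWeight z + g z * gaussWeight z) =
      π ^ d * rexp c := by
    rw [integral_const_mul, integral_add ((integrable_gaussWeight d).const_mul (1 - c)) hgi,
      integral_const_mul, integral_gaussWeight, hgint]
    ring
  have hd : 0 < ‖S.det‖ ^ 2 := by positivity
  rw [hobj, Real.exp_add, exp_log hd, ← mul_assoc, mul_comm]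
  refine mul_le_mul_of_nonneg_left ?_ hd.le
  rw [← hlhs]
  exact hle

/-! ### First-order conditions and the upper bound -/

/-- The right derivative at t = 0 of a function that never exceeds its value there is nonpositive.
-/
theorem sum_div_add_le_of_log_le {n : ℕ} (a b : Fin n → ℝ) (ha : ∀ i, 0 < a i) (D q m : ℝ)
    (hD : 0 < D)
    (h : ∀ t : ℝ, 0 < t → (∑ i, log (a i + t * b i)) + log (D * (1 + t * q)) - t * m ≤
      (∑ i, log (a i)) + log D) :
    (∑ i, b i / a i) + q ≤ m := by
  let f : ℝ → ℝ := fun t => (∑ i, log (a i + t * b i)) + log (D * (1 + t * q)) - t * m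
  have h1 : ∀ i, HasDerivAt (fun t : ℝ => log (a i + t * b i)) (b i / a i) 0 := by
    intro i
    have := (((hasDerivAt_id (0 : ℝ)).mul_const (b i)).const_add (a i)).log
      (by simpa using (ha i).ne')
    simpa using this
  have h2 : HasDerivAt (fun t : ℝ => log (D * (1 + t * q))) q 0 := by
    have := ((((hasDerivAt_id (0 : ℝ)).mul_const q).const_add 1).const_mul D).log
      (by simpa using hD.ne')
    simpa [hD.ne'] using this
  have h3 : HasDerivAt f ((∑ i, b i / a i) + q - m) 0 := by
    have := ((HasDerivAt.fun_sum fun i (_ : i ∈ Finset.univ) => h1 i).fun_add h2).fun_sub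
      ((hasDerivAt_id (0 : ℝ)).mul_const m)
    simpa using this
  have h4 := h3.tendsto_slope_zero_right
  have h5 : (∑ i, b i / a i) + q - m ≤ 0 := by
    refine le_of_tendsto h4 ?_
    filter_upwards [self_mem_nhdsWithin] with t ht
    have ht : 0 < t := ht
    have : f (0 + t) - f 0 ≤ 0 := by
      have := h t ht
      simp only [f, zero_add, zero_mul, add_zero, mul_one, sub_zero]
      linarith
    rw [smul_eq_mul]
    exact mul_nonpos_of_nonneg_of_nonpos (by positivity) this
  linarith

/-- The perturbed matrix is S (1 + t x x†) Sᴴ, so its determinant follows from the matrix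
determinant lemma. -/
theorem objective_add_smul_vecMulVec {n d : ℕ} (V : Matrix (Fin n) (Fin d) ℂ)
    (S : Matrix (Fin d) (Fin d) ℂ) (x : Fin d → ℂ) (t : ℝ) :
    objective V (S * Sᴴ + (t : ℂ) • Matrix.vecMulVec (S *ᵥ x) (star (S *ᵥ x))) =
      (∑ i, log ((∑ j, ‖(V * S) i j‖ ^ 2) + t * ‖(V *ᵥ (S *ᵥ x)) i‖ ^ 2))
        + log (‖S.det‖ ^ 2 * (1 + t * ∑ k, ‖x k‖ ^ 2))
        - ((∑ k, ∑ j, ‖S k j‖ ^ 2) + t * ∑ k, ‖(S *ᵥ x) k‖ ^ 2) + d := by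
  have hvec : ∀ (m : ℕ) (u : Fin m → ℂ) (i : Fin m),
      Matrix.vecMulVec u (star u) i i = ((‖u i‖ ^ 2 : ℝ) : ℂ) := by
    intro m u i
    rw [Matrix.vecMulVec_apply, Pi.star_apply, RCLike.star_def, Complex.mul_conj']
    push_cast
    rfl
  have e1 : ∀ i, ((V * (S * Sᴴ + (t : ℂ) • Matrix.vecMulVec (S *ᵥ x) (star (S *ᵥ x))) * Vᴴ) i i).re
      = (∑ j, ‖(V * S) i j‖ ^ 2) + t * ‖(V *ᵥ (S *ᵥ x)) i‖ ^ 2 := by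
    intro i
    rw [Matrix.mul_add, Matrix.add_mul, Matrix.add_apply, mul_self_mul_conjTranspose_apply_self,
      Matrix.mul_smul, Matrix.smul_mul, Matrix.mul_vecMulVec, Matrix.vecMulVec_mul,
      ← Matrix.star_mulVec, Matrix.smul_apply, hvec, smul_eq_mul, ← Complex.ofReal_mul,
      ← Complex.ofReal_add, Complex.ofReal_re]
  have e2 : (S * Sᴴ + (t : ℂ) • Matrix.vecMulVec (S *ᵥ x) (star (S *ᵥ x))).det.re =
      ‖S.det‖ ^ 2 * (1 + t * ∑ k, ‖x k‖ ^ 2) := by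
    have : S * Sᴴ + (t : ℂ) • Matrix.vecMulVec (S *ᵥ x) (star (S *ᵥ x)) =
        S * (1 + Matrix.vecMulVec ((t : ℂ) • x) (star x)) * Sᴴ := by
      rw [Matrix.mul_add, Matrix.add_mul, Matrix.mul_one, Matrix.mul_vecMulVec,
        Matrix.vecMulVec_mul, ← Matrix.star_mulVec, Matrix.mulVec_smul, Matrix.smul_vecMulVec]
    have hdet : (1 + Matrix.vecMulVec ((t : ℂ) • x) (star x)).det =
        ((1 + t * ∑ k, ‖x k‖ ^ 2 : ℝ) : ℂ) := by
      rw [Matrix.vecMulVec_eq Unit, Matrix.det_one_add_replicateCol_mul_replicateRow]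
      simp only [dotProduct, Pi.star_apply, RCLike.star_def, Pi.smul_apply, smul_eq_mul]
      push_cast
      rw [Finset.mul_sum]
      congr 1
      refine Finset.sum_congr rfl fun k _ => ?_
      rw [← Complex.conj_mul']
      ring
    rw [this, Matrix.det_mul, Matrix.det_mul, mul_right_comm, ← Matrix.det_mul, hdet,
      Complex.re_mul_ofReal, det_self_mul_conjTranspose_re]
  have e3 : (S * Sᴴ + (t : ℂ) • Matrix.vecMulVec (S *ᵥ x) (star (S *ᵥ x))).trace.re =
      (∑ k, ∑ j, ‖S k j‖ ^ 2) + t * ∑ k, ‖(S *ᵥ x) k‖ ^ 2 := by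
    rw [Matrix.trace_add, Complex.add_re, trace_self_mul_conjTranspose_re, Matrix.trace_smul]
    simp only [Matrix.trace, Matrix.diag_apply, hvec]
    rw [← Complex.ofReal_sum, smul_eq_mul, ← Complex.ofReal_mul, Complex.ofReal_re]
  simp only [objective_eq, e1, e2, e3]

section Maximizer

variable {n d : ℕ} {V : Matrix (Fin n) (Fin d) ℂ} {S : Matrix (Fin d) (Fin d) ℂ}

/-- As quadratic forms: Sᴴ (∑ v_i v_i† / a_i) S + 1 ≤ Sᴴ S. Moving in the direction (Sx)(Sx)† with t
> 0 stays in the cone and gives just this inequality, which suffices. -/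
theorem stationarity_le (hV : ∀ i, V i ≠ 0) (hS : S.det ≠ 0)
    (hmax : ∀ Y : Matrix (Fin d) (Fin d) ℂ, Y.PosDef → objective V Y ≤ objective V (S * Sᴴ))
    (x : Fin d → ℂ) :
    (∑ i, ‖(V *ᵥ (S *ᵥ x)) i‖ ^ 2 / ∑ j, ‖(V * S) i j‖ ^ 2) + ∑ k, ‖x k‖ ^ 2 ≤
      ∑ k, ‖(S *ᵥ x) k‖ ^ 2 := by
  refine sum_div_add_le_of_log_le _ _ (fun i => sum_norm_sq_pos (mul_row_ne_zero hS (hV i)))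
    (‖S.det‖ ^ 2) _ _ (by positivity) fun t ht => ?_
  have hpos : (S * Sᴴ + (t : ℂ) • Matrix.vecMulVec (S *ᵥ x) (star (S *ᵥ x))).PosDef :=
    (posDef_self_mul_conjTranspose hS).add_posSemidef
      ((Matrix.posSemidef_vecMulVec_self_star _).smul (by exact_mod_cast ht.le))
  have h := hmax _ hpos
  rw [objective_add_smul_vecMulVec, objective_self_mul_conjTranspose] at h
  linarith

/-- Along X ↦ sX the objective changes by (n + d) log s - (s - 1) tr X, which must be critical at s
= 1. -/
theorem trace_eq_of_isMax (hV : ∀ i, V i ≠ 0) (hS : S.det ≠ 0)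
    (hmax : ∀ Y : Matrix (Fin d) (Fin d) ℂ, Y.PosDef → objective V Y ≤ objective V (S * Sᴴ)) :
    ∑ k, ∑ j, ‖S k j‖ ^ 2 = n + d := by
  set T := ∑ k, ∑ j, ‖S k j‖ ^ 2 with hT
  let f : ℝ → ℝ := fun s => (n + d) * log s - s * T
  have hder : HasDerivAt f (n + d - T) 1 := by
    have := ((hasDerivAt_log (one_ne_zero (α := ℝ))).const_mul ((n : ℝ) + d)).fun_sub
      ((hasDerivAt_id (1 : ℝ)).mul_const T)
    simpa using this
  have hloc : IsLocalMax f 1 := by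
    filter_upwards [lt_mem_nhds (zero_lt_one (α := ℝ))] with s hs
    have hpos : (((s : ℂ)) • (S * Sᴴ)).PosDef :=
      (posDef_self_mul_conjTranspose hS).smul (by exact_mod_cast hs)
    have h := hmax _ hpos
    have e1 : ∀ i, ((V * ((s : ℂ) • (S * Sᴴ)) * Vᴴ) i i).re = s * ∑ j, ‖(V * S) i j‖ ^ 2 := by
      intro i
      rw [Matrix.mul_smul, Matrix.smul_mul, Matrix.smul_apply,
        mul_self_mul_conjTranspose_apply_self, smul_eq_mul, ← Complex.ofReal_mul,
        Complex.ofReal_re]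
    have e2 : ((s : ℂ) • (S * Sᴴ)).det.re = s ^ d * ‖S.det‖ ^ 2 := by
      rw [Matrix.det_smul, Fintype.card_fin, ← Complex.ofReal_pow, Complex.re_ofReal_mul,
        det_self_mul_conjTranspose_re]
    have e3 : ((s : ℂ) • (S * Sᴴ)).trace.re = s * T := by
      rw [Matrix.trace_smul, smul_eq_mul, Complex.re_ofReal_mul, trace_self_mul_conjTranspose_re]
    rw [objective_self_mul_conjTranspose, objective_eq, e2, e3] at h
    simp only [e1] at h
    have e4 : ∀ i, log (s * ∑ j, ‖(V * S) i j‖ ^ 2) = log s + log (∑ j, ‖(V * S) i j‖ ^ 2) :=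
      fun i => log_mul hs.ne' (sum_norm_sq_pos (mul_row_ne_zero hS (hV i))).ne'
    rw [log_mul (by positivity) (by positivity), log_pow] at h
    simp only [e4, Finset.sum_add_distrib, Finset.sum_const, Finset.card_univ, Fintype.card_fin,
      nsmul_eq_mul] at h
    simp only [f, log_one]
    linarith
  have := hloc.hasDerivAt_eq_zero hder
  linarith

theorem integral_le_exp_objective (hV : ∀ i, V i ≠ 0) (hS : S.det ≠ 0)
    (hmax : ∀ Y : Matrix (Fin d) (Fin d) ℂ, Y.PosDef → objective V Y ≤ objective V (S * Sᴴ)) :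
    ∫ z : Fin d → ℂ, (∏ i, ‖(V *ᵥ z) i‖ ^ 2) * gaussWeight z ≤
      π ^ d * rexp (objective V (S * Sᴴ)) := by
  have ha : ∀ i, 0 < ∑ j, ‖(V * S) i j‖ ^ 2 :=
    fun i => sum_norm_sq_pos (mul_row_ne_zero hS (hV i))
  set a : Fin n → ℝ := fun i => ∑ j, ‖(V * S) i j‖ ^ 2 with haa
  rw [integral_comp_mulVec S hS]
  have hint := integrable_comp_mulVec S hS (integrable_prod_mulVec V)
  -- Since tr X = n + d, the terms -tr X + d leave e^{-n}, shared out as one e^{-1} per factor.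
  have hobj : rexp (objective V (S * Sᴴ)) = (∏ i, a i * rexp (-1)) * ‖S.det‖ ^ 2 := by
    rw [objective_self_mul_conjTranspose, trace_eq_of_isMax hV hS hmax,
      show ∀ p q : ℝ, p + q - (n + d) + d = p + q + -n from fun p q => by ring, Real.exp_add,
      Real.exp_add, Real.exp_sum, exp_log (by positivity), Finset.prod_mul_distrib,
      Finset.prod_const, Finset.card_univ, Fintype.card_fin, ← Real.exp_nat_mul]
    simp only [exp_log (ha _), haa]
    ring_nf
  have hle : ∀ z : Fin d → ℂ, (∏ i, ‖(V *ᵥ (S *ᵥ z)) i‖ ^ 2) * gaussWeight (S *ᵥ z) ≤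
      (∏ i, a i * rexp (-1)) * gaussWeight z := by
    intro z
    have hst := stationarity_le hV hS hmax z
    have hw : gaussWeight (S *ᵥ z) ≤
        (∏ i, rexp (-(‖(V *ᵥ (S *ᵥ z)) i‖ ^ 2 / a i))) * gaussWeight z := by
      rw [gaussWeight, gaussWeight, ← Real.exp_sum, ← Real.exp_add, Finset.sum_neg_distrib]
      apply Real.exp_le_exp.2
      linarith
    refine (mul_le_mul_of_nonneg_left hw (by positivity)).trans ?_
    rw [← mul_assoc, ← Finset.prod_mul_distrib]
    refine mul_le_mul_of_nonneg_right ?_ (gaussWeight_pos z).le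
    refine Finset.prod_le_prod (fun i _ => by positivity) fun i _ => ?_
    set y := ‖(V *ᵥ (S *ᵥ z)) i‖ ^ 2
    have hai : 0 < a i := ha i
    -- Gives y/a ≤ e^{y/a - 1}, that is, y e^{-y/a} ≤ a/e.
    have h1 := add_one_le_exp (y / a i - 1)
    have h2 : rexp (-1) = rexp (y / a i - 1) * rexp (-(y / a i)) := by
      rw [← Real.exp_add]; ring_nf
    rw [h2, ← mul_assoc]
    refine mul_le_mul_of_nonneg_right ?_ (exp_pos _).le
    calc y = a i * (y / a i) := by field_simp
      _ ≤ _ := mul_le_mul_of_nonneg_left (by linarith) hai.le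
  have h := integral_mono hint ((integrable_gaussWeight d).const_mul _) hle
  rw [integral_const_mul, integral_gaussWeight] at h
  rw [hobj]
  calc _ ≤ ‖S.det‖ ^ 2 * ((∏ i, a i * rexp (-1)) * π ^ d) :=
        mul_le_mul_of_nonneg_left h (by positivity)
    _ = _ := by ring

end Maximizer

/-! ### Existence of a maximizer -/

open scoped MatrixOrder in
theorem norm_apply_le_trace {d : ℕ} {X : Matrix (Fin d) (Fin d) ℂ} (hX : X.PosSemidef)
    (i j : Fin d) : ‖X i j‖ ≤ X.trace.re := by
  obtain ⟨B, hB⟩ := CStarAlgebra.nonneg_iff_eq_star_mul_self.1 hX.nonneg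
  have hB' : X = Bᴴ * Bᴴᴴ := by rw [Matrix.conjTranspose_conjTranspose]; exact hB
  generalize Bᴴ = S at hB'
  subst hB'
  rw [trace_self_mul_conjTranspose_re]
  have hle : ∀ k, ∑ l, ‖S k l‖ ^ 2 ≤ ∑ k, ∑ j, ‖S k j‖ ^ 2 := fun k =>
    Finset.single_le_sum (f := fun k => ∑ j, ‖S k j‖ ^ 2)
      (fun _ _ => Finset.sum_nonneg fun _ _ => by positivity) (Finset.mem_univ k)
  have h1 : ‖(S * Sᴴ) i j‖ ≤ ∑ l, (‖S i l‖ ^ 2 + ‖S j l‖ ^ 2) / 2 := by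
    rw [Matrix.mul_apply]
    refine (norm_sum_le _ _).trans (Finset.sum_le_sum fun l _ => ?_)
    rw [norm_mul, Matrix.conjTranspose_apply, norm_star]
    nlinarith [sq_nonneg (‖S i l‖ - ‖S j l‖)]
  rw [← Finset.sum_div, Finset.sum_add_distrib] at h1
  linarith [hle i, hle j]

theorem isClosed_setOf_posSemidef (d : ℕ) :
    IsClosed {X : Matrix (Fin d) (Fin d) ℂ | X.PosSemidef} := by
  simp only [Matrix.posSemidef_iff_dotProduct_mulVec, Set.ofPred_and, Set.ofPred_forall]
  refine IsClosed.inter ?_ (isClosed_iInter fun x => ?_)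
  · exact isClosed_eq (by fun_prop) continuous_id
  · exact isClosed_le continuous_const (by fun_prop)

theorem isCompact_setOf_posSemidef_trace_le (d : ℕ) (R : ℝ) :
    IsCompact {X : Matrix (Fin d) (Fin d) ℂ | X.PosSemidef ∧ X.trace.re ≤ R} := by
  have hK : IsCompact (Set.univ.pi fun _ : Fin d => Set.univ.pi fun _ : Fin d =>
      Metric.closedBall (0 : ℂ) R) :=
    isCompact_univ_pi fun _ => isCompact_univ_pi fun _ => isCompact_closedBall _ _
  refine hK.of_isClosed_subset ?_ fun X hX => ?_
  · exact (isClosed_setOf_posSemidef d).inter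
      (isClosed_le (Complex.continuous_re.comp continuous_id.matrix_trace) continuous_const)
  · simp only [Set.mem_univ_pi, mem_closedBall_zero_iff]
    exact fun i j => (norm_apply_le_trace hX.1 i j).trans hX.2

/-- The exponential of the objective, up to the factor `e^d`; it extends continuously by zero to
singular matrices. -/
noncomputable def expObjective {n d : ℕ} (V : Matrix (Fin n) (Fin d) ℂ)
    (X : Matrix (Fin d) (Fin d) ℂ) : ℝ :=
  (∏ i, ((V * X * Vᴴ) i i).re) * X.det.re * rexp (-X.trace.re)

theorem continuous_expObjective {n d : ℕ} (V : Matrix (Fin n) (Fin d) ℂ) :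
    Continuous (expObjective V) := by
  unfold expObjective
  have h : ∀ i, Continuous fun X : Matrix (Fin d) (Fin d) ℂ => ((V * X * Vᴴ) i i).re := fun i =>
    Complex.continuous_re.comp ((by fun_prop :
      Continuous fun X : Matrix (Fin d) (Fin d) ℂ => V * X * Vᴴ).matrix_elem i i)
  exact ((continuous_finsetProd _ fun i _ => h i).mul (by fun_prop)).mul (by fun_prop)

/-- With X = S Sᴴ this entry is the squared norm of row `i` of V S, nonzero because S is invertible.
-/
theorem apply_re_pos {n d : ℕ} {V : Matrix (Fin n) (Fin d) ℂ}
    {X : Matrix (Fin d) (Fin d) ℂ} (hX : X.PosDef) {i : Fin n} (hV : V i ≠ 0) :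
    0 < ((V * X * Vᴴ) i i).re := by
  obtain ⟨S, hS, rfl⟩ := exists_eq_self_mul_conjTranspose hX
  rw [mul_self_mul_conjTranspose_apply_self, Complex.ofReal_re]
  exact sum_norm_sq_pos (mul_row_ne_zero hS hV)

theorem det_re_pos {d : ℕ} {X : Matrix (Fin d) (Fin d) ℂ} (hX : X.PosDef) : 0 < X.det.re := by
  obtain ⟨S, hS, rfl⟩ := exists_eq_self_mul_conjTranspose hX
  rw [det_self_mul_conjTranspose_re]
  positivity

theorem expObjective_pos {n d : ℕ} {V : Matrix (Fin n) (Fin d) ℂ} (hV : ∀ i, V i ≠ 0)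
    {X : Matrix (Fin d) (Fin d) ℂ} (hX : X.PosDef) : 0 < expObjective V X :=
  mul_pos (mul_pos (Finset.prod_pos fun i _ => apply_re_pos hX (hV i)) (det_re_pos hX)) (exp_pos _)

theorem objective_eq_log {n d : ℕ} {V : Matrix (Fin n) (Fin d) ℂ} (hV : ∀ i, V i ≠ 0)
    {X : Matrix (Fin d) (Fin d) ℂ} (hX : X.PosDef) :
    objective V X = log (expObjective V X) + d := by
  have h1 : ∀ i, ((V * X * Vᴴ) i i).re ≠ 0 := fun i => (apply_re_pos hX (hV i)).ne'
  rw [objective_eq, expObjective, log_mul (mul_ne_zero (Finset.prod_ne_zero_iff.2 fun i _ => h1 i)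
    (det_re_pos hX).ne') (exp_pos _).ne', log_mul (Finset.prod_ne_zero_iff.2 fun i _ => h1 i)
    (det_re_pos hX).ne', log_exp, log_prod fun i _ => h1 i]
  ring

/-- Entries of a positive semidefinite matrix are at most its trace t in modulus, so each diagonal
factor is O(t) and the determinant is at most d! t^d. This forces decay for large trace. -/
theorem exists_expObjective_le {n d : ℕ} (V : Matrix (Fin n) (Fin d) ℂ) :
    ∃ C : ℝ, ∀ X : Matrix (Fin d) (Fin d) ℂ, X.PosSemidef →
      expObjective V X ≤ C * (X.trace.re ^ (n + d) * rexp (-X.trace.re)) := by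
  refine ⟨(∏ i, ∑ k, ∑ j, ‖V i j‖ * ‖V i k‖) * d.factorial, fun X hX => ?_⟩
  have hent := norm_apply_le_trace hX
  set t := X.trace.re with ht
  have h1 : ∀ i, |((V * X * Vᴴ) i i).re| ≤ (∑ k, ∑ j, ‖V i j‖ * ‖V i k‖) * t := by
    intro i
    refine (Complex.abs_re_le_norm _).trans ?_
    simp only [Matrix.mul_apply, Finset.sum_mul]
    refine (norm_sum_le _ _).trans (Finset.sum_le_sum fun k _ => ?_)
    refine (norm_sum_le _ _).trans (Finset.sum_le_sum fun j _ => ?_)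
    rw [norm_mul, norm_mul, Matrix.conjTranspose_apply, norm_star]
    calc _ = ‖V i j‖ * ‖V i k‖ * ‖X j k‖ := by ring
      _ ≤ _ := mul_le_mul_of_nonneg_left (hent j k) (by positivity)
  have h2 : |X.det.re| ≤ d.factorial * t ^ d := by
    refine (Complex.abs_re_le_norm _).trans ?_
    have := Matrix.det_le (A := X) (abv := NormedField.toAbsoluteValue ℂ) hent
    simp only [Fintype.card_fin, nsmul_eq_mul] at this
    exact this
  calc expObjective V X ≤ |(∏ i, ((V * X * Vᴴ) i i).re) * X.det.re| * rexp (-t) :=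
        mul_le_mul_of_nonneg_right (le_abs_self _) (exp_pos _).le
    _ ≤ ((∏ i, (∑ k, ∑ j, ‖V i j‖ * ‖V i k‖) * t) * (d.factorial * t ^ d)) * rexp (-t) := by
        rw [abs_mul, Finset.abs_prod]
        refine mul_le_mul_of_nonneg_right (mul_le_mul ?_ h2 (abs_nonneg _) ?_) (exp_pos _).le
        · exact Finset.prod_le_prod (fun _ _ => abs_nonneg _) fun i _ => h1 i
        · exact Finset.prod_nonneg fun i _ => (abs_nonneg _).trans (h1 i)
    _ = _ := by
        rw [Finset.prod_mul_distrib, Finset.prod_const, Finset.card_univ, Fintype.card_fin]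
        ring

theorem exists_isMax_objective {n d : ℕ} {V : Matrix (Fin n) (Fin d) ℂ} (hV : ∀ i, V i ≠ 0) :
    ∃ X : Matrix (Fin d) (Fin d) ℂ, X.PosDef ∧
      ∀ Y : Matrix (Fin d) (Fin d) ℂ, Y.PosDef → objective V Y ≤ objective V X := by
  have hone : (1 : Matrix (Fin d) (Fin d) ℂ).PosDef := Matrix.PosDef.one
  have hF1 := expObjective_pos hV hone
  obtain ⟨C, hC⟩ := exists_expObjective_le V
  have hlim := (Real.tendsto_pow_mul_exp_neg_atTop_nhds_zero (n + d)).const_mul C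
  rw [mul_zero] at hlim
  obtain ⟨R, hR⟩ := Filter.eventually_atTop.1 (hlim.eventually (gt_mem_nhds hF1))
  -- The identity must lie in the compact set: its value is the one to beat outside, and it keeps
  -- the maximizer nonsingular.
  set R' := max R (1 : Matrix (Fin d) (Fin d) ℂ).trace.re
  obtain ⟨X, hXK, hX⟩ := (isCompact_setOf_posSemidef_trace_le d R').exists_isMaxOn
    ⟨1, hone.posSemidef, le_max_right _ _⟩ (continuous_expObjective V).continuousOn
  have hge : expObjective V 1 ≤ expObjective V X := hX ⟨hone.posSemidef, le_max_right _ _⟩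
  have hdet : X.det ≠ 0 := by
    intro h
    have : expObjective V X = 0 := by simp [expObjective, h]
    linarith
  have hpd : X.PosDef := hXK.1.posDef_iff_det_ne_zero.2 hdet
  refine ⟨X, hpd, fun Y hY => ?_⟩
  rw [objective_eq_log hV hY, objective_eq_log hV hpd]
  gcongr
  · exact expObjective_pos hV hY
  · by_cases h : Y.trace.re ≤ R'
    · exact hX ⟨hY.posSemidef, h⟩
    · exact ((hC Y hY.posSemidef).trans
        (hR _ ((le_max_left _ _).trans (not_le.1 h).le)).le).trans hge

/-! ### Existence and uniqueness of Gram factors -/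

/-- Keep the eigenvectors of nonzero eigenvalue, scaled by the square roots of the eigenvalues;
there are rank A of them. -/
theorem exists_isGramFactor {n : ℕ} {A : Matrix (Fin n) (Fin n) ℂ} (hA : A.PosSemidef) :
    ∃ V : Matrix (Fin n) (Fin A.rank) ℂ, IsGramFactor A V := by
  have hH := hA.isHermitian
  let e : Fin A.rank ≃ {i // hH.eigenvalues i ≠ 0} :=
    (Fintype.equivFinOfCardEq hH.rank_eq_card_non_zero_eigs.symm).symm
  let U : Matrix (Fin n) (Fin n) ℂ := hH.eigenvectorUnitary
  let V : Matrix (Fin n) (Fin A.rank) ℂ :=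
    Matrix.of fun i k => U i (e k) * ((√(hH.eigenvalues (e k)) : ℝ) : ℂ)
  have hV : A = V * Vᴴ := by
    have hs : A = U * Matrix.diagonal (fun l => (hH.eigenvalues l : ℂ)) * Uᴴ := hH.spectral_theorem
    ext i j
    have h1 : A i j = ∑ l, U i l * (hH.eigenvalues l : ℂ) * conj (U j l) := by
      conv_lhs => rw [hs, Matrix.mul_apply]
      simp [Matrix.mul_diagonal]
    have h2 : ∑ l, U i l * (hH.eigenvalues l : ℂ) * conj (U j l) =
        ∑ l : {l // hH.eigenvalues l ≠ 0}, U i l * (hH.eigenvalues l : ℂ) * conj (U j l) := by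
      rw [← Fintype.sum_subtype_add_sum_subtype (fun l => hH.eigenvalues l ≠ 0), add_eq_left]
      refine Finset.sum_eq_zero fun l _ => ?_
      rw [not_not.1 l.2]
      simp
    rw [h1, h2, ← Equiv.sum_comp e, Matrix.mul_apply]
    refine Finset.sum_congr rfl fun k _ => ?_
    have h3 : ((√(hH.eigenvalues (e k)) : ℝ) : ℂ) * ((√(hH.eigenvalues (e k)) : ℝ) : ℂ) =
        hH.eigenvalues (e k) := by
      rw [← Complex.ofReal_mul, mul_self_sqrt (hA.eigenvalues_nonneg _)]
    simp only [V, Matrix.conjTranspose_apply, Matrix.of_apply, RCLike.star_def, map_mul,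
      Complex.conj_ofReal]
    rw [← h3]
    ring
  exact ⟨V, hV, by rw [← Matrix.rank_self_mul_conjTranspose, ← hV]⟩

theorem isUnit_det_conjTranspose_mul_self {n d : ℕ} {V : Matrix (Fin n) (Fin d) ℂ}
    (hV : V.rank = d) : IsUnit (Vᴴ * V).det := by
  rw [← Matrix.isUnit_iff_isUnit_det, ← Matrix.mulVec_surjective_iff_isUnit]
  have h : (Vᴴ * V).rank = d := by rw [Matrix.rank_conjTranspose_mul_self, hV]
  have ht : (Vᴴ * V).mulVecLin.range = ⊤ := by
    refine Submodule.eq_top_of_finrank_eq ?_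
    rw [← Matrix.rank, h, Module.finrank_fin_fun]
  exact LinearMap.range_eq_top.1 ht

/-- Two full-rank Gram factors of the same matrix differ by a unitary. -/
theorem exists_unitary_of_isGramFactor {n d : ℕ} {A : Matrix (Fin n) (Fin n) ℂ}
    {V W : Matrix (Fin n) (Fin d) ℂ} (hV : IsGramFactor A V) (hW : IsGramFactor A W) :
    ∃ U : Matrix (Fin d) (Fin d) ℂ, U * Uᴴ = 1 ∧ W = V * U := by
  have hv := isUnit_det_conjTranspose_mul_self hV.2
  have hw := isUnit_det_conjTranspose_mul_self hW.2
  have hVW : V * Vᴴ = W * Wᴴ := hV.1.symm.trans hW.1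
  have hLV : (Vᴴ * V)⁻¹ * Vᴴ * V = 1 := by
    rw [Matrix.mul_assoc, Matrix.nonsing_inv_mul _ hv]
  -- The left inverse (Vᴴ V)⁻¹ Vᴴ of V applied to W is the only candidate.
  refine ⟨(Vᴴ * V)⁻¹ * Vᴴ * W, ?_, ?_⟩
  · have : Vᴴ * ((Vᴴ * V)⁻¹ * Vᴴ)ᴴ = 1 := by
      rw [← Matrix.conjTranspose_mul, hLV, Matrix.conjTranspose_one]
    rw [Matrix.conjTranspose_mul]
    calc _ = (Vᴴ * V)⁻¹ * Vᴴ * (W * Wᴴ) * ((Vᴴ * V)⁻¹ * Vᴴ)ᴴ := by simp only [Matrix.mul_assoc]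
      _ = ((Vᴴ * V)⁻¹ * Vᴴ * V) * (Vᴴ * ((Vᴴ * V)⁻¹ * Vᴴ)ᴴ) := by
        rw [← hVW]; simp only [Matrix.mul_assoc]
      _ = 1 := by rw [hLV, this, Matrix.mul_one]
  -- The identity is checked after multiplying by the invertible Wᴴ W, which brings in W Wᴴ = V Vᴴ.
  · have h1 : V * ((Vᴴ * V)⁻¹ * Vᴴ * W) * (Wᴴ * W) = W * (Wᴴ * W) := by
      calc _ = V * ((Vᴴ * V)⁻¹ * Vᴴ) * (W * Wᴴ) * W := by simp only [Matrix.mul_assoc]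
        _ = V * ((Vᴴ * V)⁻¹ * Vᴴ * V) * Vᴴ * W := by rw [← hVW]; simp only [Matrix.mul_assoc]
        _ = W * Wᴴ * W := by rw [hLV, Matrix.mul_one, hVW]
        _ = _ := Matrix.mul_assoc _ _ _
    calc W = W * (Wᴴ * W) * (Wᴴ * W)⁻¹ := (Matrix.mul_nonsing_inv_cancel_right _ _ hw).symm
      _ = _ := by rw [← h1, Matrix.mul_nonsing_inv_cancel_right _ _ hw]

/-- The substitution X ↦ U X Uᴴ permutes the positive definite matrices and preserves determinant
and trace. -/
theorem image_objective_mul_unitary {n d : ℕ} (V : Matrix (Fin n) (Fin d) ℂ)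
    {U : Matrix (Fin d) (Fin d) ℂ} (hU : U * Uᴴ = 1) :
    objective (V * U) '' {X | X.PosDef} = objective V '' {X | X.PosDef} := by
  have hU' : Uᴴ * U = 1 := mul_eq_one_comm.1 hU
  have key : ∀ X, objective (V * U) X = objective V (U * X * Uᴴ) := by
    intro X
    have h1 : V * U * X * (V * U)ᴴ = V * (U * X * Uᴴ) * Vᴴ := by
      rw [Matrix.conjTranspose_mul]; simp only [Matrix.mul_assoc]
    have h2 : (U * X * Uᴴ).det = X.det := by
      rw [Matrix.det_mul_right_comm, hU, Matrix.one_mul]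
    have h3 : (U * X * Uᴴ).trace = X.trace := by
      rw [Matrix.trace_mul_cycle, hU', Matrix.one_mul]
    simp only [objective_eq, h1, h2, h3]
  have hpd : ∀ {U : Matrix (Fin d) (Fin d) ℂ}, U * Uᴴ = 1 → ∀ X : Matrix (Fin d) (Fin d) ℂ,
      X.PosDef → (U * X * Uᴴ).PosDef := fun {U} hU X hX =>
    ((Matrix.IsUnit.posDef_star_right_conjugate_iff (IsUnit.of_mul_eq_one _ hU)).2 hX)
  ext y
  constructor
  · rintro ⟨X, hX, rfl⟩
    exact ⟨U * X * Uᴴ, hpd hU X hX, (key X).symm⟩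
  · rintro ⟨X, hX, rfl⟩
    refine ⟨Uᴴ * X * Uᴴᴴ, hpd (by rwa [Matrix.conjTranspose_conjTranspose]) X hX, ?_⟩
    rw [key, Matrix.conjTranspose_conjTranspose]
    congr 1
    calc _ = (U * Uᴴ) * X * (U * Uᴴ) := by simp only [Matrix.mul_assoc]
      _ = X := by rw [hU, Matrix.one_mul, Matrix.mul_one]

theorem phi_eq_of_isGramFactor {n d e : ℕ} {A : Matrix (Fin n) (Fin n) ℂ}
    {V : Matrix (Fin n) (Fin d) ℂ} {W : Matrix (Fin n) (Fin e) ℂ} (hV : IsGramFactor A V)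
    (hW : IsGramFactor A W) : Phi V = Phi W := by
  have hd : d = e := by
    rw [← hV.2, ← hW.2, ← Matrix.rank_self_mul_conjTranspose, ← hV.1, hW.1,
      Matrix.rank_self_mul_conjTranspose]
  subst hd
  obtain ⟨U, hU, rfl⟩ := exists_unitary_of_isGramFactor hV hW
  rw [Phi, Phi, image_objective_mul_unitary V hU]

theorem isGramFactor_gramFactor {n : ℕ} {A : Matrix (Fin n) (Fin n) ℂ} (hA : A.PosSemidef) :
    IsGramFactor A (gramFactor A) :=
  Classical.epsilon_spec (exists_isGramFactor hA)

theorem row_ne_zero_iff {n d : ℕ} {A : Matrix (Fin n) (Fin n) ℂ}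
    {V : Matrix (Fin n) (Fin d) ℂ} (hV : IsGramFactor A V) (i : Fin n) :
    A i i ≠ 0 ↔ V i ≠ 0 := by
  rw [hV.1, self_mul_conjTranspose_apply_self]
  constructor
  · intro h h0
    simp [h0] at h
  · intro h
    exact_mod_cast (sum_norm_sq_pos h).ne'

theorem hatP_of_forall_ne {n d : ℕ} {A : Matrix (Fin n) (Fin n) ℂ} (hA : A.PosSemidef)
    (h : ∀ i, A i i ≠ 0) {V : Matrix (Fin n) (Fin d) ℂ} (hV : IsGramFactor A V) :
    hatP A = rexp (Phi V) := by
  rw [hatP, if_neg (by simpa using h), phi_eq_of_isGramFactor (isGramFactor_gramFactor hA) hV]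

theorem phi_eq_objective {n d : ℕ} {V : Matrix (Fin n) (Fin d) ℂ} {X : Matrix (Fin d) (Fin d) ℂ}
    (hX : X.PosDef) (hmax : ∀ Y : Matrix (Fin d) (Fin d) ℂ, Y.PosDef →
      objective V Y ≤ objective V X) :
    IsGreatest (objective V '' {X | X.PosDef}) (Phi V) ∧ Phi V = objective V X := by
  have h : IsGreatest (objective V '' {X | X.PosDef}) (objective V X) :=
    ⟨⟨X, hX, rfl⟩, by rintro _ ⟨Y, hY, rfl⟩; exact hmax Y hY⟩
  have h2 : Phi V = objective V X := h.csSup_eq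
  exact ⟨h2 ▸ h, h2⟩

end EntropicPermanent

/-! ### The sandwich -/

theorem mainTheorem1 (n : ℕ) (A : Matrix (Fin n) (Fin n) ℂ) (hA : A.PosSemidef) :
    -- `A` has a full-rank Gram factor with `d = rank A`
    (∃ V : Matrix (Fin n) (Fin A.rank) ℂ, EntropicPermanent.IsGramFactor A V) ∧
    -- without zero diagonal entries: for every such factor the maximum defining `Φ(V)` is attained,
    -- and `P̂(A) = exp Φ(V)`
    ((∀ i, A i i ≠ 0) → ∀ (d : ℕ) (V : Matrix (Fin n) (Fin d) ℂ),
      EntropicPermanent.IsGramFactor A V →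
        IsGreatest (EntropicPermanent.objective V '' {X | X.PosDef}) (EntropicPermanent.Phi V) ∧
        EntropicPermanent.hatP A = Real.exp (EntropicPermanent.Phi V)) ∧
    -- the sandwich; the permanent is a real number
    A.permanent.im = 0 ∧
    Real.exp (-Real.eulerMascheroniConstant * n) * EntropicPermanent.hatP A ≤ A.permanent.re ∧
    A.permanent.re ≤ EntropicPermanent.hatP A := by
  open EntropicPermanent in
  refine ⟨exists_isGramFactor hA, fun h d V hV => ?_, ?_⟩
  · obtain ⟨X, hX, hmax⟩ := exists_isMax_objective fun i => (row_ne_zero_iff hV i).1 (h i)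
    exact ⟨(phi_eq_objective hX hmax).1, hatP_of_forall_ne hA h hV⟩
  · have hV := isGramFactor_gramFactor hA
    generalize gramFactor A = V at hV
    have hI := ofReal_integral_prod_mulVec V
    rw [← hV.1] at hI
    set I := ∫ z : Fin A.rank → ℂ, (∏ i, ‖(V *ᵥ z) i‖ ^ 2) * gaussWeight z
    have hpi : 0 < Real.pi ^ A.rank := by positivity
    have hper : A.permanent = ((I / Real.pi ^ A.rank : ℝ) : ℂ) := by
      push_cast
      rw [hI, mul_div_cancel_left₀]
      exact_mod_cast hpi.ne'
    rw [hper, Complex.ofReal_im, Complex.ofReal_re]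
    refine ⟨rfl, ?_⟩
    by_cases h : ∀ i, A i i ≠ 0
    · have hrow := fun i => (row_ne_zero_iff hV i).1 (h i)
      obtain ⟨X, hX, hmax⟩ := exists_isMax_objective hrow
      rw [hatP_of_forall_ne hA h hV, (phi_eq_objective hX hmax).2]
      obtain ⟨S, hS, rfl⟩ := exists_eq_self_mul_conjTranspose hX
      constructor
      · rw [le_div_iff₀ hpi, ← Real.exp_add]
        refine le_trans (le_of_eq ?_) (exp_objective_le_integral V hrow S hS)
        rw [mul_comm]
        ring_nf
      · rw [div_le_iff₀ hpi, mul_comm]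
        exact integral_le_exp_objective hrow hS hmax
    -- A zero diagonal entry means a zero row of V, so the Wick integrand vanishes and all three
    -- quantities are 0.
    · push Not at h
      rw [hatP, if_pos h]
      obtain ⟨i, hi⟩ := h
      have hVi : V i = 0 := by
        by_contra h0
        exact (row_ne_zero_iff hV i).2 h0 hi
      have hI0 : I = 0 := by
        refine (MeasureTheory.integral_congr_ae (Filter.Eventually.of_forall fun z => ?_)).trans
          (MeasureTheory.integral_zero _ _)
        have : (V *ᵥ z) i = 0 := by
          change V i ⬝ᵥ z = 0
          rw [hVi, zero_dotProduct]
        rw [Finset.prod_eq_zero (Finset.mem_univ i) (by simp [this]), zero_mul]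
      simp [hI0]
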